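/- Let $\{Z_s : s\in\mathbb Z^2\}$ be iid unit Fréchet random variables, $P(Z_s\le x)=e^{-1/x}$ for $x>0$, let $0<\phi<1$, let $\|\cdot\|$ be the Euclidean norm, and let $X_t=\max_{s\in\mathbb Z^2}\phi^{\|s\|}Z_{t-s}$, $t\in\mathbb Z^2$. For $j,k\in\mathbb N$ and $\rho\in\mathbb R$ put $$\alpha_{j,k}(\rho)=\sup\bigl\{|P(A\cap B)-P(A)P(B)| : A\in\sigma(X_s,s\in S),\ B\in\sigma(X_s,s\in T)\bigr\},$$ where the supremum is also over all $S,T\subset\mathbb Z^2$ with $\#S\le j$, $\#T\le k$ and $\|s-t\|\ge \rho$ for all $s\in S$, $t\in T$. Fix $\gamma\ge 0$, let $B_\gamma=\{s\in\mathbb Z^2:\|s\|\le\gamma\}$ and $c=\#B_\gamma$, and let $a_x$ $(x\in\mathbb R)$ be real numbers such that $P(|X_0|>a_x)\sim 1/x$ as $x\to\infty$. Let $(m_n)$ and $(r_n)$ be real sequences with $m_n\to\infty$, $r_n\to\infty$, $$r_n^2=o(m_n),\qquad \log m_n=o(r_n),\qquad \log n=o(m_n)\qquad(n\to\infty).$$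 Then, writing $a_m$ for $a_{m_n}$, 1. for every $\epsilon>0$, $\displaystyle\lim_{k\to\infty}\limsup_{n\to\infty} m_n\sum_{l\in\mathbb Z^2,\,k<\|l\|\le r_n}P\Bigl(\max_{s\in B_\gamma}|X_s|>\epsilon a_m,\ \max_{s'\in B_\gamma+l}|X_{s'}|>\epsilon a_m\Bigr)=0$; 2. $\displaystyle\lim_{n\to\infty}m_n\sum_{l\in\mathbb Z^2,\,\|l\|>r_n}\alpha_{c,c}(\|l\|)=0$; 3. $\displaystyle\sum_{l\in\mathbb Z^2}\alpha_{j_1,j_2}(\|l\|)<\infty$ for all $j_1,j_2$ with $2c\le j_1+j_2\le 4c$; 4. $\displaystyle\lim_{n\to\infty}n\,m_n^{1/2}\,\alpha_{c,cn^2}(m_n)=0$. -/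

import Mathlib

open MeasureTheory ProbabilityTheory Filter Topology Asymptotics
open scoped ENNReal

namespace ExtremogramMMA

/-- The Euclidean norm of a lattice point of `ℤ^d` (the instance norm on `Fin d → ℤ` is the sup
norm, so it is not used). The distance of `s` and `t` is `latticeNorm (s - t)`. -/
noncomputable def latticeNorm {d : ℕ} (l : Fin d → ℤ) : ℝ :=
  ‖(WithLp.toLp 2 (fun i => (l i : ℝ)) : EuclideanSpace ℝ (Fin d))‖

/-- The closed Euclidean lattice ball `B_γ + l = {s ∈ ℤ^d : d(l, s) ≤ γ}` of radius `γ`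
centred at `l`. -/
def latticeBall {d : ℕ} (γ : ℝ) (l : Fin d → ℤ) : Set (Fin d → ℤ) :=
  {s | latticeNorm (s - l) ≤ γ}

/-- Lattice balls are finite, so that `Set.ncard` below is their true cardinality. -/
theorem latticeBall_finite {d : ℕ} (γ : ℝ) (l : Fin d → ℤ) : (latticeBall γ l).Finite := by
  refine (Set.finite_Icc (fun i => l i - ⌈γ⌉) (fun i => l i + ⌈γ⌉)).subset ?_
  intro s hs
  have key : ∀ i, |s i - l i| ≤ ⌈γ⌉ := by
    intro i
    have h1 := PiLp.norm_apply_le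
      (WithLp.toLp 2 (fun i => ((s - l) i : ℝ)) : EuclideanSpace ℝ (Fin d)) i
    have h2 : |((s i - l i : ℤ) : ℝ)| ≤ γ := by
      have := h1.trans hs
      simpa [Real.norm_eq_abs] using this
    have h3 : ((|s i - l i| : ℤ) : ℝ) ≤ (⌈γ⌉ : ℝ) := by
      rw [Int.cast_abs]
      exact h2.trans (Int.le_ceil γ)
    exact_mod_cast h3
  constructor
  · intro i
    have := abs_le.1 (key i)
    simp only
    omega
  · intro i
    have := abs_le.1 (key i)
    simp only
    omega

/-- The number `c = # B_γ` of lattice points in the ball of radius `γ` centred at the origin of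
`ℤ^d`. -/
noncomputable def ballCard (d : ℕ) (γ : ℝ) : ℕ := (latticeBall γ (0 : Fin d → ℤ)).ncard

section Mixing

variable {Ω : Type*} [MeasurableSpace Ω]

/-- The `α`-mixing coefficient `sup {|P(A ∩ B) - P(A) P(B)| : A ∈ 𝒜, B ∈ ℬ}` of two `σ`-fields,
as an element of `[0, ∞]`. -/
noncomputable def alphaCoeff (P : Measure Ω) (𝒜 ℬ : MeasurableSpace Ω) : ℝ≥0∞ :=
  ⨆ (A : Set Ω) (_ : MeasurableSet[𝒜] A) (B : Set Ω) (_ : MeasurableSet[ℬ] B),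
    ENNReal.ofReal |P.real (A ∩ B) - P.real A * P.real B|

/-- The `σ`-field `σ(X_s, s ∈ S)` generated by the field `X` over the set `S` of sites. -/
def fieldSigma {d : ℕ} (X : (Fin d → ℤ) → Ω → ℝ) (S : Set (Fin d → ℤ)) : MeasurableSpace Ω :=
  ⨆ s ∈ S, (inferInstance : MeasurableSpace ℝ).comap (X s)

/-- The mixing function `α_{j,k}(ρ)` of the random field `X`: the supremum of
`α(σ(X_s, s ∈ S), σ(X_s, s ∈ T))` over all `S, T ⊆ ℤ^d` with `# S ≤ j`, `# T ≤ k` and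
`d(S, T) ≥ ρ`. -/
noncomputable def alphaMix {d : ℕ} (P : Measure Ω) (X : (Fin d → ℤ) → Ω → ℝ) (j k : ℕ) (ρ : ℝ) :
    ℝ≥0∞ :=
  ⨆ (S : Finset (Fin d → ℤ)) (T : Finset (Fin d → ℤ)) (_ : S.card ≤ j) (_ : T.card ≤ k)
    (_ : ∀ s ∈ S, ∀ t ∈ T, ρ ≤ latticeNorm (s - t)),
    alphaCoeff P (fieldSigma X S) (fieldSigma X T)

/-- The event `max_{s ∈ B_γ + l} |X_s| > x` (the ball is finite, so the maximum exceeds `x` exactly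
when one of the values does). -/
def ballExceed {d : ℕ} (X : (Fin d → ℤ) → Ω → ℝ) (γ : ℝ) (l : Fin d → ℤ) (x : ℝ) : Set Ω :=
  {ω | ∃ s ∈ latticeBall γ l, x < |X s ω|}

/-- The anti-clustering and mixing conditions on a random field `X` on `ℤ^d`, for a radius `γ`,
sequences `m = m_n` and `r = r_n`, and thresholds `a_m`. All the sums have nonnegative terms and
are taken in `[0, ∞]`. -/
structure ClusterMixingConditions {d : ℕ} (P : Measure Ω) (X : (Fin d → ℤ) → Ω → ℝ) (γ : ℝ)
    (m r : ℕ → ℝ) (a : ℝ → ℝ) : Prop where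
  /-- `lim_k limsup_n m_n ∑_{k < ‖l‖ ≤ r_n} P(max_{B_γ} |X| > ε a_m, max_{B_γ + l} |X| > ε a_m) = 0`
  for every `ε > 0`. -/
  anticluster : ∀ ε : ℝ, 0 < ε →
    Tendsto (fun k : ℕ => limsup (fun n : ℕ => ENNReal.ofReal (m n) *
        ∑' l : {l : Fin d → ℤ // (k : ℝ) < latticeNorm l ∧ latticeNorm l ≤ r n},
          P (ballExceed X γ 0 (ε * a (m n)) ∩ ballExceed X γ l.1 (ε * a (m n)))) atTop)
      atTop (𝓝 0)
  /-- `lim_n m_n ∑_{‖l‖ > r_n} α_{c,c}(‖l‖) = 0`. -/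
  mixing_tail :
    Tendsto (fun n : ℕ => ENNReal.ofReal (m n) *
        ∑' l : {l : Fin d → ℤ // r n < latticeNorm l},
          alphaMix P X (ballCard d γ) (ballCard d γ) (latticeNorm l.1))
      atTop (𝓝 0)
  /-- `∑_l α_{j₁,j₂}(‖l‖) < ∞` whenever `2c ≤ j₁ + j₂ ≤ 4c`. -/
  mixing_summable : ∀ j₁ j₂ : ℕ, 2 * ballCard d γ ≤ j₁ + j₂ → j₁ + j₂ ≤ 4 * ballCard d γ →
    ∑' l : Fin d → ℤ, alphaMix P X j₁ j₂ (latticeNorm l) < ∞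
  /-- `lim_n n^{d/2} m_n^{1/2} α_{c, c n^d}(m_n) = 0`. -/
  mixing_block :
    Tendsto (fun n : ℕ =>
        ENNReal.ofReal ((n : ℝ) ^ ((d : ℝ) / 2) * (m n) ^ ((1 : ℝ) / 2)) *
          alphaMix P X (ballCard d γ) (ballCard d γ * n ^ d) (m n))
      atTop (𝓝 0)

/-- `Z` is an iid family of unit Fréchet random variables:
`P(Z_s ≤ x) = exp(-1/x)` for `x > 0` (hence `Z_s > 0` almost surely). -/
structure IsIIDUnitFrechet {ι : Type*} (P : Measure Ω) (Z : ι → Ω → ℝ) : Prop where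
  measurable : ∀ s, Measurable (Z s)
  indep : iIndepFun Z P
  cdf_eq : ∀ s, ∀ x : ℝ, 0 < x → P.real {ω | Z s ω ≤ x} = Real.exp (-(1 / x))

/-- The max-moving average `X_t = max_{s ∈ ℤ^2} φ^{‖s‖} Z_{t-s}`. For `0 < φ < 1` and iid unit
Fréchet `Z` the weights are summable, and the family is almost surely bounded above with its
supremum attained. -/
noncomputable def maxMovingAverage (φ : ℝ) (Z : (Fin 2 → ℤ) → Ω → ℝ) (t : Fin 2 → ℤ) (ω : Ω) : ℝ :=
  ⨆ s : Fin 2 → ℤ, φ ^ latticeNorm s * Z (t - s) ω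

end Mixing

end ExtremogramMMA

namespace ExtremogramMMA

/-! Everything rests on the summability of `φ^(c‖l‖)` and two Fréchet bounds, `P(Z > y) ≤ 1/y` and
`P(Z ≤ y) ≤ y`.

Mixing. `X_t` depends only on noise near `t` unless some distant `v` has `φ^‖t-v‖ Z_v > Z_t`, an
event of probability at most `2 φ^(‖t-v‖/2)`. Replacing `X` on `S` and on `T` by functions of the
noise on disjoint sets of sites makes the two sides independent, so `α_{j,k}(ρ)` is at most a
constant times `(j + k) φ^(ρ/8)` (`alphaMix_maxMovingAverage_le`). Conditions 2 to 4 follow since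
the exponential beats `m_n`, and powers of `n`, under the growth hypotheses
(`tendsto_mul_rpow_zero`).

Anti-clustering. If `X_s` and `X_t` both exceed `y`, either one noise site causes both, which costs
`φ^(‖s-t‖/4) / y`, or two independent sites do, which costs `1/y²` (`measure_pair_exceed_le`). Since
`a_m ≥ m/4` eventually (`eventually_div_four_le`), summing over `k < ‖l‖ ≤ r_n` and multiplying by
`m_n` leaves `O(φ^(k/8)) + O(r_n²/m_n)`. -/

theorem latticeNorm_nonneg {d : ℕ} (l : Fin d → ℤ) : 0 ≤ latticeNorm l := norm_nonneg _

theorem latticeNorm_zero {d : ℕ} : latticeNorm (0 : Fin d → ℤ) = 0 := by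
  simp [latticeNorm, EuclideanSpace.norm_eq]

theorem latticeNorm_neg {d : ℕ} (l : Fin d → ℤ) : latticeNorm (-l) = latticeNorm l := by
  simp [latticeNorm, EuclideanSpace.norm_eq]

theorem latticeNorm_add_le {d : ℕ} (x y : Fin d → ℤ) :
    latticeNorm (x + y) ≤ latticeNorm x + latticeNorm y := by
  unfold latticeNorm
  refine le_trans (le_of_eq ?_) (norm_add_le _ _)
  congr 1
  ext i
  simp

theorem latticeNorm_sub_comm {d : ℕ} (x y : Fin d → ℤ) :
    latticeNorm (x - y) = latticeNorm (y - x) := by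
  rw [← latticeNorm_neg, neg_sub]

theorem latticeNorm_sub_le {d : ℕ} (x y z : Fin d → ℤ) :
    latticeNorm (x - z) ≤ latticeNorm (x - y) + latticeNorm (y - z) := by
  simpa using latticeNorm_add_le (x - y) (y - z)

theorem abs_apply_le_latticeNorm {d : ℕ} (l : Fin d → ℤ) (i : Fin d) :
    |(l i : ℝ)| ≤ latticeNorm l := by
  simpa [Real.norm_eq_abs, latticeNorm] using
    PiLp.norm_apply_le (WithLp.toLp 2 (fun i => (l i : ℝ)) : EuclideanSpace ℝ (Fin d)) i

/-! ### Exponential weights and sums over the lattice. -/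

theorem summable_pow_natAbs {q : ℝ} (hq0 : 0 ≤ q) (hq1 : q < 1) :
    Summable (fun n : ℤ => q ^ n.natAbs) := by
  have h := summable_geometric_of_lt_one hq0 hq1
  exact summable_int_iff_summable_nat_and_neg.2 ⟨by simpa using h, by simpa using h⟩

theorem summable_rpow_mul_latticeNorm {φ c : ℝ} (hφ0 : 0 < φ) (hφ1 : φ < 1) (hc : 0 < c) :
    Summable (fun l : Fin 2 → ℤ => φ ^ (c * latticeNorm l)) := by
  have hq0 : 0 < φ ^ (c / 2) := Real.rpow_pos_of_pos hφ0 _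
  have hq1 : φ ^ (c / 2) < 1 := Real.rpow_lt_one hφ0.le hφ1 (by positivity)
  have h1 := summable_pow_natAbs hq0.le hq1
  have h2 := h1.mul_of_nonneg h1 (fun n => by positivity) (fun n => by positivity)
  have h3 := (finTwoArrowEquiv ℤ).summable_iff.2 h2
  refine Summable.of_nonneg_of_le (fun l => by positivity) (fun l => ?_) h3
  have e : ∀ n : ℤ, (φ ^ (c / 2)) ^ n.natAbs = φ ^ (c / 2 * |(n : ℝ)|) := by
    intro n
    rw [← Real.rpow_natCast, ← Real.rpow_mul hφ0.le, Nat.cast_natAbs, Int.cast_abs]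
  simp only [Function.comp, finTwoArrowEquiv_apply, e]
  rw [← Real.rpow_add hφ0]
  -- `‖l‖ ≥ (|l 0| + |l 1|) / 2`, so a product of two geometric series dominates.
  refine Real.rpow_le_rpow_of_exponent_ge hφ0 hφ1.le ?_
  have a0 := abs_apply_le_latticeNorm l 0
  have a1 := abs_apply_le_latticeNorm l 1
  change c / 2 * |(l 0 : ℝ)| + c / 2 * |(l 1 : ℝ)| ≤ c * latticeNorm l
  nlinarith

/-- The total mass `∑_l φ^{c ‖l‖}` of exponentially decaying weights on `ℤ^2`. -/
noncomputable def weightSum (φ c : ℝ) : ℝ≥0∞ :=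
  ∑' l : Fin 2 → ℤ, ENNReal.ofReal (φ ^ (c * latticeNorm l))

theorem weightSum_ne_top {φ c : ℝ} (hφ0 : 0 < φ) (hφ1 : φ < 1) (hc : 0 < c) :
    weightSum φ c ≠ ∞ :=
  (summable_rpow_mul_latticeNorm hφ0 hφ1 hc).tsum_ofReal_ne_top

theorem tsum_ofReal_rpow_sub (φ c : ℝ) (t : Fin 2 → ℤ) :
    ∑' u : Fin 2 → ℤ, ENNReal.ofReal (φ ^ (c * latticeNorm (t - u))) = weightSum φ c :=
  (Equiv.subLeft t).tsum_eq (fun u => ENNReal.ofReal (φ ^ (c * latticeNorm u)))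

/-- Half of the exponent pays for the distance `R`; the other half remains available for summation.
-/
theorem ofReal_rpow_le_mul {φ c R x : ℝ} (hφ0 : 0 < φ) (hφ1 : φ < 1) (hc : 0 < c) (h : R ≤ x) :
    ENNReal.ofReal (φ ^ (c * x)) ≤
      ENNReal.ofReal (φ ^ (c / 2 * R)) * ENNReal.ofReal (φ ^ (c / 2 * x)) := by
  rw [← ENNReal.ofReal_mul (by positivity), ← Real.rpow_add hφ0]
  refine ENNReal.ofReal_le_ofReal (Real.rpow_le_rpow_of_exponent_ge hφ0 hφ1.le ?_)
  nlinarith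

theorem tsum_subtype_rpow_le {φ c R : ℝ} (hφ0 : 0 < φ) (hφ1 : φ < 1) (hc : 0 < c)
    {p : (Fin 2 → ℤ) → Prop} (hp : ∀ l, p l → R ≤ latticeNorm l) :
    ∑' l : {l // p l}, ENNReal.ofReal (φ ^ (c * latticeNorm l.1)) ≤
      ENNReal.ofReal (φ ^ (c / 2 * R)) * weightSum φ (c / 2) := by
  calc _ ≤ ∑' l : {l // p l}, ENNReal.ofReal (φ ^ (c / 2 * R)) *
        ENNReal.ofReal (φ ^ (c / 2 * latticeNorm l.1)) :=
        ENNReal.tsum_le_tsum fun l => ofReal_rpow_le_mul hφ0 hφ1 hc (hp l.1 l.2)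
    _ ≤ _ := by
        rw [ENNReal.tsum_mul_left]
        gcongr
        exact ENNReal.tsum_comp_le_tsum_of_injective Subtype.val_injective
          (fun l : Fin 2 → ℤ => ENNReal.ofReal (φ ^ (c / 2 * latticeNorm l)))

theorem tsum_subtype_const_le {r : ℝ} (hr : 0 ≤ r) (b : ℝ≥0∞)
    {p : (Fin 2 → ℤ) → Prop} (hp : ∀ l, p l → latticeNorm l ≤ r) :
    ∑' _l : {l // p l}, b ≤ ENNReal.ofReal ((2 * r + 1) ^ 2) * b := by
  set N : ℕ := ⌊r⌋₊
  set F : Finset (Fin 2 → ℤ) := Finset.Icc (fun _ => -(N : ℤ)) (fun _ => (N : ℤ))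
  have hF : ∀ l, p l → l ∈ F := by
    intro l hl
    have key : ∀ i, |l i| ≤ (N : ℤ) := by
      intro i
      have h1 := (abs_apply_le_latticeNorm l i).trans (hp l hl)
      have h2 : ((l i).natAbs : ℝ) ≤ r := by rwa [Nat.cast_natAbs, Int.cast_abs]
      have h3 := Nat.le_floor h2
      rw [Int.abs_eq_natAbs]
      exact_mod_cast h3
    exact Finset.mem_Icc.2 ⟨fun i => (abs_le.1 (key i)).1, fun i => (abs_le.1 (key i)).2⟩
  have hcard : (F.card : ℝ) ≤ (2 * r + 1) ^ 2 := by
    have h1 : F.card = (2 * N + 1) ^ 2 := by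
      simp only [F, Pi.card_Icc, Int.card_Icc, Finset.prod_const, Finset.card_univ,
        Fintype.card_fin]
      congr 1
      omega
    rw [h1]
    push_cast
    have := Nat.floor_le hr
    gcongr
  calc ∑' _l : {l // p l}, b ≤ ∑' _l : F, b :=
        ENNReal.tsum_comp_le_tsum_of_injective
          (f := fun l : {l // p l} => (⟨l.1, hF l.1 l.2⟩ : F))
          (fun x y h => Subtype.ext (by simpa using h)) (fun _ => b)
    _ = (F.card : ℝ≥0∞) * b := by simp
    _ ≤ _ := by
        gcongr
        rw [← ENNReal.ofReal_natCast]
        exact ENNReal.ofReal_le_ofReal hcard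

/-! ### Tail bounds for unit Fréchet variables. -/

namespace IsIIDUnitFrechet

variable {Ω ι : Type*} [MeasurableSpace Ω] {P : Measure Ω} [IsProbabilityMeasure P]
  {Z : ι → Ω → ℝ}

theorem real_lt (hZ : IsIIDUnitFrechet P Z) (s : ι) {y : ℝ} (hy : 0 < y) :
    P.real {ω | y < Z s ω} = 1 - Real.exp (-(1 / y)) := by
  have h : MeasurableSet {ω | Z s ω ≤ y} := hZ.measurable s measurableSet_Iic
  rw [← hZ.cdf_eq s y hy, ← probReal_compl_eq_one_sub h]
  congr 1
  ext ω
  simp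

theorem measure_lt_le (hZ : IsIIDUnitFrechet P Z) (s : ι) {y : ℝ} (hy : 0 < y) :
    P {ω | y < Z s ω} ≤ ENNReal.ofReal (1 / y) := by
  rw [← ofReal_measureReal, hZ.real_lt s hy]
  refine ENNReal.ofReal_le_ofReal ?_
  linarith [Real.add_one_le_exp (-(1 / y))]

theorem measure_le_le (hZ : IsIIDUnitFrechet P Z) (s : ι) {y : ℝ} (hy : 0 < y) :
    P {ω | Z s ω ≤ y} ≤ ENNReal.ofReal y := by
  rw [← ofReal_measureReal, hZ.cdf_eq s y hy]
  refine ENNReal.ofReal_le_ofReal ?_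
  rw [Real.exp_neg]
  have h1 := Real.add_one_le_exp (1 / y)
  have h2 : 0 < 1 / y := by positivity
  calc (Real.exp (1 / y))⁻¹ ≤ (1 / y)⁻¹ := by gcongr; linarith
    _ = y := by simp

theorem measure_nonpos (hZ : IsIIDUnitFrechet P Z) (s : ι) : P {ω | Z s ω ≤ 0} = 0 := by
  refine le_antisymm (ENNReal.le_of_forall_pos_le_add fun ε hε _ => ?_) bot_le
  rw [zero_add]
  refine (measure_mono fun ω (hω : Z s ω ≤ 0) => ?_).trans
    ((hZ.measure_le_le s (y := ε) (by exact_mod_cast hε)).trans (by simp))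
  exact hω.trans ε.2

theorem ae_pos [Countable ι] (hZ : IsIIDUnitFrechet P Z) : ∀ᵐ ω ∂P, ∀ s, 0 < Z s ω := by
  rw [ae_all_iff]
  intro s
  rw [ae_iff]
  simpa using hZ.measure_nonpos s

theorem measure_lt_mul_le (hZ : IsIIDUnitFrechet P Z) (s : ι) {w y : ℝ} (hw : 0 < w)
    (hy : 0 < y) : P {ω | y < w * Z s ω} ≤ ENNReal.ofReal (w / y) := by
  have h := hZ.measure_lt_le s (div_pos hy hw)
  rw [one_div_div] at h
  refine (measure_mono fun ω hω => ?_).trans h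
  simp only [Set.mem_ofPred_eq] at hω ⊢
  rwa [div_lt_iff₀' hw]

/-- Splitting at level `w`: either `Z s ≤ w` or `w * Z t > 1`, and each has probability at most `w`.
Independence plays no role. -/
theorem measure_lt_sq_mul_le (hZ : IsIIDUnitFrechet P Z) (s t : ι) {w : ℝ} (hw : 0 < w) :
    P {ω | Z s ω < w * w * Z t ω} ≤ 2 * ENNReal.ofReal w := by
  have hsub : {ω | Z s ω < w * w * Z t ω} ⊆ {ω | Z s ω ≤ w} ∪ {ω | w < w * w * Z t ω} := by
    intro ω hω
    simp only [Set.mem_union, Set.mem_ofPred_eq] at hω ⊢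
    by_contra! h
    linarith
  refine (measure_mono hsub).trans ((measure_union_le _ _).trans ?_)
  rw [two_mul]
  refine add_le_add (hZ.measure_le_le s hw) ((hZ.measure_lt_mul_le t (by positivity) hw).trans ?_)
  rw [mul_div_assoc, div_self hw.ne', mul_one]

end IsIIDUnitFrechet

/-! ### Marginal behaviour of the field and growth of the thresholds. -/

theorem maxMovingAverage_eq {Ω : Type*} (φ : ℝ) (Z : (Fin 2 → ℤ) → Ω → ℝ) (t : Fin 2 → ℤ) (ω : Ω) :
    maxMovingAverage φ Z t ω = ⨆ u : Fin 2 → ℤ, φ ^ latticeNorm (t - u) * Z u ω := by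
  unfold maxMovingAverage
  rw [← (Equiv.subLeft t).iSup_comp]
  simp

section ExceedanceBounds

variable {Ω : Type*} [MeasurableSpace Ω] {P : Measure Ω}
  {Z : (Fin 2 → ℤ) → Ω → ℝ} {φ : ℝ}

theorem ae_exists_lt_of_lt_abs_maxMovingAverage [IsProbabilityMeasure P] (hZ : IsIIDUnitFrechet P Z)
    (hφ0 : 0 < φ) (t : Fin 2 → ℤ) (y : ℝ) :
    ∀ᵐ ω ∂P, y < |maxMovingAverage φ Z t ω| →
      ∃ u : Fin 2 → ℤ, y < φ ^ latticeNorm (t - u) * Z u ω := by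
  filter_upwards [hZ.ae_pos] with ω hω h
  rw [maxMovingAverage_eq, abs_of_nonneg (Real.iSup_nonneg fun u => by have := hω u; positivity)]
    at h
  exact exists_lt_of_lt_ciSup h

/-- The union bound gives `P(sup > n) ≤ weightSum φ 1 / n`. Boundedness matters because a real `⨆`
takes the value `0` on unbounded families, which would spoil the lower bound `X_0 ≥ Z_0`. -/
theorem ae_bddAbove [IsProbabilityMeasure P] (hZ : IsIIDUnitFrechet P Z)
    (hφ0 : 0 < φ) (hφ1 : φ < 1) (t : Fin 2 → ℤ) :
    ∀ᵐ ω ∂P, BddAbove (Set.range fun u : Fin 2 → ℤ => φ ^ latticeNorm (t - u) * Z u ω) := by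
  have hle : ∀ n : ℕ, 0 < n → P {ω | ∃ u : Fin 2 → ℤ, (n : ℝ) < φ ^ latticeNorm (t - u) * Z u ω} ≤
      weightSum φ 1 * (n : ℝ≥0∞)⁻¹ := by
    intro n hn
    rw [Set.ofPred_exists]
    refine (measure_iUnion_le _).trans ?_
    rw [← tsum_ofReal_rpow_sub φ 1 t, ← ENNReal.tsum_mul_right]
    refine ENNReal.tsum_le_tsum fun u => ?_
    have hn' : (0 : ℝ) < n := by exact_mod_cast hn
    refine (hZ.measure_lt_mul_le u (by positivity) hn').trans (le_of_eq ?_)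
    rw [ENNReal.ofReal_div_of_pos hn', ENNReal.ofReal_natCast, one_mul, div_eq_mul_inv]
  have hlim : Tendsto (fun n : ℕ => weightSum φ 1 * (n : ℝ≥0∞)⁻¹) atTop (𝓝 0) := by
    simpa using ENNReal.Tendsto.const_mul ENNReal.tendsto_inv_nat_nhds_zero
      (Or.inr (weightSum_ne_top hφ0 hφ1 one_pos))
  rw [ae_iff]
  refine le_antisymm (ge_of_tendsto hlim ?_) bot_le
  filter_upwards [eventually_gt_atTop 0] with n hn
  refine (measure_mono fun ω hω => ?_).trans (hle n hn)
  by_contra hcon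
  simp only [Set.mem_ofPred_eq, not_exists, not_lt] at hcon
  exact hω ⟨n, by rintro _ ⟨u, rfl⟩; exact hcon u⟩

theorem one_sub_exp_le_real_lt_abs [IsProbabilityMeasure P] (hZ : IsIIDUnitFrechet P Z)
    (hφ0 : 0 < φ) (hφ1 : φ < 1) {x y : ℝ} (hy : 0 < y) (hxy : x ≤ y) :
    1 - Real.exp (-(1 / y)) ≤ P.real {ω | x < |maxMovingAverage φ Z 0 ω|} := by
  rw [← hZ.real_lt 0 hy]
  refine ENNReal.toReal_mono (measure_ne_top _ _) (measure_mono_ae ?_)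
  filter_upwards [ae_bddAbove hZ hφ0 hφ1 0] with ω hω h
  change y < Z 0 ω at h
  change x < |maxMovingAverage φ Z 0 ω|
  rw [maxMovingAverage_eq]
  have h1 := le_ciSup hω 0
  simp only [sub_self, latticeNorm_zero, Real.rpow_zero, one_mul] at h1
  exact hxy.trans_lt (h.trans_le (h1.trans (le_abs_self _)))

/-- If `a x < x/4`, then `X_0 ≥ Z_0` gives a tail of at least `1 - e^(-4/x) ≥ 4/(x+4)`. For `x > 4`
this exceeds `2/x`, against the assumed equivalence with `1/x`. -/
theorem eventually_div_four_le [IsProbabilityMeasure P] (hZ : IsIIDUnitFrechet P Z)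
    (hφ0 : 0 < φ) (hφ1 : φ < 1) {a : ℝ → ℝ}
    (ha : (fun x : ℝ => P.real {ω | a x < |maxMovingAverage φ Z 0 ω|})
      ~[atTop] (fun x : ℝ => 1 / x)) : ∀ᶠ x in atTop, x / 4 ≤ a x := by
  have h1 := (isEquivalent_iff_tendsto_one (by
    filter_upwards [eventually_gt_atTop 0] with x hx
    positivity)).1 ha
  filter_upwards [h1.eventually_le_const one_lt_two, eventually_gt_atTop 4] with x hx hx4
  by_contra! hlt
  have hx0 : 0 < x := by linarith
  have h2 := one_sub_exp_le_real_lt_abs hZ hφ0 hφ1 (by linarith) hlt.le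
  simp only [Pi.div_apply, div_div_eq_mul_div, div_one] at hx
  have h3 : Real.exp (-(1 / (x / 4))) ≤ x / (x + 4) := by
    rw [Real.exp_neg, inv_le_comm₀ (Real.exp_pos _) (by positivity)]
    refine le_trans (le_of_eq ?_) (Real.add_one_le_exp _)
    field_simp
    ring
  have h4 : 1 - x / (x + 4) = 4 / (x + 4) := by field_simp; ring
  have h5 : 4 / (x + 4) * x ≤ 2 :=
    le_trans (mul_le_mul_of_nonneg_right (by linarith) hx0.le) hx
  rw [div_mul_eq_mul_div, div_le_iff₀ (by positivity)] at h5
  linarith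

end ExceedanceBounds

/-! ### Mixing coefficients by approximation with independent fields. -/

theorem alphaCoeff_le_one {Ω : Type*} (𝒜 ℬ : MeasurableSpace Ω) [MeasurableSpace Ω]
    (P : Measure Ω) [IsProbabilityMeasure P] :
    alphaCoeff P 𝒜 ℬ ≤ 1 := by
  refine iSup₂_le fun A _ => iSup₂_le fun B _ => ?_
  rw [← ENNReal.ofReal_one]
  refine ENNReal.ofReal_le_ofReal (abs_le.2 ?_)
  have h0 : ∀ s, 0 ≤ P.real s := fun s => measureReal_nonneg
  have h1 : ∀ s, P.real s ≤ 1 := fun s => measureReal_le_one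
  constructor <;> nlinarith [h0 A, h0 B, h1 A, h1 B, h0 (A ∩ B), h1 (A ∩ B)]

theorem alphaMix_le_one {Ω : Type*} [MeasurableSpace Ω] (P : Measure Ω) [IsProbabilityMeasure P]
    {d : ℕ} (X : (Fin d → ℤ) → Ω → ℝ) (j k : ℕ) (ρ : ℝ) : alphaMix P X j k ρ ≤ 1 :=
  iSup₂_le fun _ _ => iSup₂_le fun _ _ => iSup_le fun _ => alphaCoeff_le_one _ _ P

/-- Writing events through a set `E` of values allows the same `E` to be evaluated on an
approximating field. -/
theorem exists_preimage_of_measurableSet_fieldSigma {Ω : Type*} {d : ℕ}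
    {X : (Fin d → ℤ) → Ω → ℝ} {S : Finset (Fin d → ℤ)}
    {A : Set Ω} (hA : MeasurableSet[fieldSigma X S] A) :
    ∃ E : Set (S → ℝ), MeasurableSet E ∧ (fun ω (s : S) => X s ω) ⁻¹' E = A := by
  have h : fieldSigma X S ≤
      MeasurableSpace.comap (fun ω (s : S) => X s ω) (inferInstance : MeasurableSpace (S → ℝ)) := by
    refine iSup₂_le fun s hs => ?_
    rw [← measurable_iff_comap_le]
    exact (measurable_pi_apply (X := fun _ : S => ℝ) ⟨s, hs⟩).comp
      (comap_measurable fun ω (s : S) => X s ω)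
  exact h A hA

/-- If the fields `Y` on `S` and `Y'` on `T` are independent, the mixing coefficient of `X`
between `S` and `T` is controlled by the probabilities of `X ≠ Y` on `S` and `X ≠ Y'` on `T`. -/
theorem alphaCoeff_fieldSigma_le {Ω : Type*} {m₁ m₂ : MeasurableSpace Ω} [MeasurableSpace Ω]
    {P : Measure Ω} [IsProbabilityMeasure P] {d : ℕ} {X Y Y' : (Fin d → ℤ) → Ω → ℝ}
    {S T : Finset (Fin d → ℤ)} (hind : Indep m₁ m₂ P)
    (hY : ∀ s ∈ S, Measurable[m₁] (Y s)) (hY' : ∀ t ∈ T, Measurable[m₂] (Y' t)) :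
    alphaCoeff P (fieldSigma X S) (fieldSigma X T) ≤
      2 * (∑ s ∈ S, P {ω | X s ω ≠ Y s ω} + ∑ t ∈ T, P {ω | X t ω ≠ Y' t ω}) := by
  refine iSup₂_le fun A hA => iSup₂_le fun B hB => ?_
  obtain ⟨E, hE, rfl⟩ := exists_preimage_of_measurableSet_fieldSigma hA
  obtain ⟨F, hF, rfl⟩ := exists_preimage_of_measurableSet_fieldSigma hB
  set A := (fun ω (s : S) => X s ω) ⁻¹' E
  set B := (fun ω (s : T) => X s ω) ⁻¹' F
  set A' := (fun ω (s : S) => Y s ω) ⁻¹' E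
  set B' := (fun ω (s : T) => Y' s ω) ⁻¹' F
  have hA' : MeasurableSet[m₁] A' :=
    (@measurable_pi_lambda _ _ _ m₁ _ _ fun s : S => hY s s.2) hE
  have hB' : MeasurableSet[m₂] B' :=
    (@measurable_pi_lambda _ _ _ m₂ _ _ fun t : T => hY' t t.2) hF
  set D : Set Ω := ⋃ s ∈ S, {ω | X s ω ≠ Y s ω}
  set D' : Set Ω := ⋃ t ∈ T, {ω | X t ω ≠ Y' t ω}
  have hAD : ∀ ω, ω ∉ D → (ω ∈ A ↔ ω ∈ A') := by
    intro ω hω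
    simp only [D, Set.mem_iUnion, Set.mem_ofPred_eq, not_exists, not_not] at hω
    have : (fun s : S => X s ω) = fun s : S => Y s ω := funext fun s => hω s s.2
    simp only [A, A', Set.mem_preimage, this]
  have hBD : ∀ ω, ω ∉ D' → (ω ∈ B ↔ ω ∈ B') := by
    intro ω hω
    simp only [D', Set.mem_iUnion, Set.mem_ofPred_eq, not_exists, not_not] at hω
    have : (fun s : T => X s ω) = fun s : T => Y' s ω := funext fun s => hω s s.2
    simp only [B, B', Set.mem_preimage, this]
  have hdiff : ∀ G G' H : Set Ω, (∀ ω, ω ∉ H → (ω ∈ G ↔ ω ∈ G')) →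
      |P.real G - P.real G'| ≤ P.real H := by
    intro G G' H h
    have h1 : P.real G ≤ P.real G' + P.real H :=
      (measureReal_mono fun ω hω => by
        by_cases hH : ω ∈ H
        · exact Or.inr hH
        · exact Or.inl ((h ω hH).1 hω)).trans (measureReal_union_le _ _)
    have h2 : P.real G' ≤ P.real G + P.real H :=
      (measureReal_mono fun ω hω => by
        by_cases hH : ω ∈ H
        · exact Or.inr hH
        · exact Or.inl ((h ω hH).2 hω)).trans (measureReal_union_le _ _)
    exact abs_le.2 ⟨by linarith, by linarith⟩
  have h1 := hdiff A A' D hAD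
  have h2 := hdiff B B' D' hBD
  have h3 := hdiff (A ∩ B) (A' ∩ B') (D ∪ D') (by
    intro ω hω
    simp only [Set.mem_union, not_or] at hω
    simp only [Set.mem_inter_iff, hAD ω hω.1, hBD ω hω.2])
  have h4 : P.real (A' ∩ B') = P.real A' * P.real B' := by
    simp only [Measure.real, (Indep_iff _ _ _).1 hind A' B' hA' hB', ENNReal.toReal_mul]
  have h5 := measureReal_union_le (μ := P) D D'
  have key : |P.real (A ∩ B) - P.real A * P.real B| ≤ 2 * (P.real D + P.real D') := by
    -- Telescoping through `P(A' ∩ B') = P(A') P(B')`; each difference is bounded by the probability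
    -- of disagreement.
    have e : P.real (A ∩ B) - P.real A * P.real B = (P.real (A ∩ B) - P.real (A' ∩ B')) +
        (P.real A' - P.real A) * P.real B' + P.real A * (P.real B' - P.real B) := by
      rw [h4]; ring
    have h6 : |(P.real A' - P.real A) * P.real B'| ≤ P.real D := by
      rw [abs_mul, abs_sub_comm, abs_of_nonneg (measureReal_nonneg (s := B'))]
      exact (mul_le_of_le_one_right (abs_nonneg _) measureReal_le_one).trans h1
    have h7 : |P.real A * (P.real B' - P.real B)| ≤ P.real D' := by
      rw [abs_mul, abs_sub_comm, abs_of_nonneg (measureReal_nonneg (s := A))]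
      exact (mul_le_of_le_one_left (abs_nonneg _) measureReal_le_one).trans h2
    rw [e]
    refine (abs_add_three _ _ _).trans ?_
    linarith
  refine (ENNReal.ofReal_le_ofReal key).trans ?_
  rw [ENNReal.ofReal_mul two_pos.le, ENNReal.ofReal_add measureReal_nonneg measureReal_nonneg,
    ofReal_measureReal (measure_ne_top P D), ofReal_measureReal (measure_ne_top P D'),
    ENNReal.ofReal_ofNat]
  gcongr
  · exact measure_biUnion_finset_le _ _
  · exact measure_biUnion_finset_le _ _

open Classical in
/-- The max-moving average in which the noise outside `U` is ignored (its contribution is replaced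
by the one of the site `t`). -/
noncomputable def truncatedAverage {Ω : Type*} (φ : ℝ) (Z : (Fin 2 → ℤ) → Ω → ℝ) (U : Set (Fin 2 → ℤ))
    (t : Fin 2 → ℤ) (ω : Ω) : ℝ :=
  ⨆ u : Fin 2 → ℤ, if u ∈ U then φ ^ latticeNorm (t - u) * Z u ω else Z t ω

theorem measurable_truncatedAverage {Ω : Type*} {m : MeasurableSpace Ω} {φ : ℝ}
    {Z : (Fin 2 → ℤ) → Ω → ℝ} {U : Set (Fin 2 → ℤ)} {t : Fin 2 → ℤ} (ht : t ∈ U)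
    (hZ : ∀ u ∈ U, Measurable (Z u)) : Measurable (truncatedAverage φ Z U t) := by
  unfold truncatedAverage
  refine Measurable.iSup fun u => ?_
  by_cases hu : u ∈ U
  · simpa only [hu, if_true] using (hZ u hu).const_mul _
  · simpa only [hu, if_false] using hZ t ht

theorem measurable_iSup_comap {Ω ι : Type*} {Z : ι → Ω → ℝ} {U : Set ι} {u : ι} (hu : u ∈ U) :
    Measurable[⨆ u ∈ U, (inferInstance : MeasurableSpace ℝ).comap (Z u)] (Z u) :=
  measurable_iff_comap_le.2 <|
    le_iSup₂ (f := fun u (_ : u ∈ U) => (inferInstance : MeasurableSpace ℝ).comap (Z u)) u hu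

/-- `Z t` is already the term `u = t`, of weight one, so ignoring terms that it dominates leaves the
supremum unchanged. -/
theorem maxMovingAverage_eq_truncatedAverage {Ω : Type*} {φ : ℝ}
    {Z : (Fin 2 → ℤ) → Ω → ℝ} {U : Set (Fin 2 → ℤ)} {t : Fin 2 → ℤ} (ht : t ∈ U)
    {ω : Ω} (h : ∀ v ∉ U, φ ^ latticeNorm (t - v) * Z v ω ≤ Z t ω) :
    maxMovingAverage φ Z t ω = truncatedAverage φ Z U t ω := by
  -- A real `⨆` is determined by its upper bounds, including the default `0` when there are none;
  -- hence boundedness is not needed.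
  have hsup : ∀ f g : (Fin 2 → ℤ) → ℝ, upperBounds (Set.range f) = upperBounds (Set.range g) →
      ⨆ u, f u = ⨆ u, g u := by
    intro f g hfg
    by_cases hb : BddAbove (Set.range f)
    · refine (isLUB_ciSup hb).unique (?_ : IsLeast _ _)
      rw [hfg]
      exact isLUB_ciSup (by rwa [BddAbove, ← hfg])
    · rw [Real.iSup_of_not_bddAbove hb, Real.iSup_of_not_bddAbove (by rwa [BddAbove, ← hfg])]
  rw [maxMovingAverage_eq]
  refine hsup _ _ (Set.ext fun b => ?_)
  simp only [mem_upperBounds, Set.forall_mem_range]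
  constructor
  · intro hb u
    split_ifs with hu
    · exact hb u
    · simpa [latticeNorm_zero] using hb t
  · intro hb u
    by_cases hu : u ∈ U
    · simpa [hu] using hb u
    · refine (h u hu).trans ?_
      simpa [ht, latticeNorm_zero] using hb t

variable {Ω : Type*} [MeasurableSpace Ω] {P : Measure Ω}
  {Z : (Fin 2 → ℤ) → Ω → ℝ} {φ : ℝ}

theorem measure_ne_truncatedAverage_le [IsProbabilityMeasure P] (hZ : IsIIDUnitFrechet P Z)
    (hφ0 : 0 < φ) (hφ1 : φ < 1) {U : Set (Fin 2 → ℤ)} {t : Fin 2 → ℤ} {R : ℝ} (ht : t ∈ U)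
    (hU : ∀ v ∉ U, R ≤ latticeNorm (t - v)) :
    P {ω | maxMovingAverage φ Z t ω ≠ truncatedAverage φ Z U t ω} ≤
      2 * (ENNReal.ofReal (φ ^ (1 / 4 * R)) * weightSum φ (1 / 4)) := by
  have hsub : {ω | maxMovingAverage φ Z t ω ≠ truncatedAverage φ Z U t ω} ⊆
      ⋃ v : (Uᶜ : Set (Fin 2 → ℤ)), {ω | Z t ω < φ ^ latticeNorm (t - v.1) * Z v.1 ω} := by
    intro ω hω
    by_contra hcon
    simp only [Set.mem_iUnion, Set.mem_ofPred_eq, not_exists, not_lt, Subtype.forall] at hcon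
    exact hω (maxMovingAverage_eq_truncatedAverage ht hcon)
  refine (measure_mono hsub).trans ((measure_iUnion_le _).trans ?_)
  calc ∑' v : (Uᶜ : Set (Fin 2 → ℤ)), P {ω | Z t ω < φ ^ latticeNorm (t - v.1) * Z v.1 ω}
      ≤ ∑' v : (Uᶜ : Set (Fin 2 → ℤ)), 2 * (ENNReal.ofReal (φ ^ (1 / 4 * R)) *
          ENNReal.ofReal (φ ^ (1 / 4 * latticeNorm (t - v.1)))) := by
        refine ENNReal.tsum_le_tsum fun v => ?_
        -- `w` is the square root of the weight. The resulting rate `1/2` is then split into `1/4`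
        -- for `R` and `1/4` for the sum over `v`.
        have h1 := hZ.measure_lt_sq_mul_le t v (w := φ ^ (1 / 2 * latticeNorm (t - v.1)))
          (by positivity)
        rw [← Real.rpow_add hφ0, ← add_mul, add_halves, one_mul] at h1
        refine h1.trans ?_
        gcongr
        refine (ofReal_rpow_le_mul hφ0 hφ1 (by norm_num) (hU v v.2)).trans (le_of_eq ?_)
        norm_num
    _ ≤ _ := by
        rw [ENNReal.tsum_mul_left, ENNReal.tsum_mul_left, ← tsum_ofReal_rpow_sub φ _ t]
        gcongr
        exact ENNReal.tsum_comp_le_tsum_of_injective Subtype.val_injective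
          (fun v : Fin 2 → ℤ => ENNReal.ofReal (φ ^ (1 / 4 * latticeNorm (t - v))))

/-- Exponential decay of the mixing function of the max-moving average. -/
theorem alphaMix_maxMovingAverage_le [IsProbabilityMeasure P] (hZ : IsIIDUnitFrechet P Z)
    (hφ0 : 0 < φ) (hφ1 : φ < 1) (j k : ℕ) {ρ : ℝ} (hρ : 0 < ρ) :
    alphaMix P (maxMovingAverage φ Z) j k ρ ≤
      4 * weightSum φ (1 / 4) * (j + k) * ENNReal.ofReal (φ ^ (1 / 8 * ρ)) := by
  refine iSup₂_le fun S T => iSup₂_le fun hS hT => iSup_le fun hST => ?_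
  -- The open `ρ/2`-neighbourhood of `S`. By the triangle inequality `T` stays at distance at least
  -- `ρ/2` from it, so noise on `U` serves `S` and noise on `Uᶜ` serves `T`.
  set U : Set (Fin 2 → ℤ) := {u | ∃ s ∈ S, latticeNorm (s - u) < ρ / 2}
  have hSU : ∀ s ∈ S, s ∈ U := fun s hs => ⟨s, hs, by simpa [latticeNorm_zero] using hρ⟩
  have hfar : ∀ t ∈ T, ∀ u ∈ U, ρ / 2 ≤ latticeNorm (t - u) := by
    rintro t ht u ⟨s, hs, hu⟩
    have h1 := hST s hs t ht
    have h2 := latticeNorm_sub_le s u t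
    rw [latticeNorm_sub_comm u t] at h2
    linarith
  have hTU : ∀ t ∈ T, t ∈ Uᶜ := fun t ht htU => by
    have := hfar t ht t htU
    simp only [sub_self, latticeNorm_zero] at this
    linarith
  have hind := indep_iSup_of_disjoint (fun u => (hZ.measurable u).comap_le) hZ.indep
    (disjoint_compl_right (a := U))
  refine (alphaCoeff_fieldSigma_le hind
    (fun s hs => measurable_truncatedAverage (φ := φ) (hSU s hs)
      fun u hu => measurable_iSup_comap hu)
    (fun t ht => measurable_truncatedAverage (φ := φ) (hTU t ht)
      fun u hu => measurable_iSup_comap hu)).trans ?_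
  have h1 : ∀ s ∈ S, P {ω | maxMovingAverage φ Z s ω ≠ truncatedAverage φ Z U s ω} ≤
      2 * (ENNReal.ofReal (φ ^ (1 / 4 * (ρ / 2))) * weightSum φ (1 / 4)) := fun s hs =>
    measure_ne_truncatedAverage_le hZ hφ0 hφ1 (hSU s hs) fun v hv => by
      by_contra! h
      exact hv ⟨s, hs, h⟩
  have h2 : ∀ t ∈ T, P {ω | maxMovingAverage φ Z t ω ≠ truncatedAverage φ Z Uᶜ t ω} ≤
      2 * (ENNReal.ofReal (φ ^ (1 / 4 * (ρ / 2))) * weightSum φ (1 / 4)) := fun t ht =>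
    measure_ne_truncatedAverage_le hZ hφ0 hφ1 (hTU t ht) fun v hv =>
      hfar t ht v (not_not.1 hv)
  have e : (1 / 4 : ℝ) * (ρ / 2) = 1 / 8 * ρ := by ring
  rw [e] at h1 h2
  calc _ ≤ 2 * (S.card • (2 * (ENNReal.ofReal (φ ^ (1 / 8 * ρ)) * weightSum φ (1 / 4))) +
        T.card • (2 * (ENNReal.ofReal (φ ^ (1 / 8 * ρ)) * weightSum φ (1 / 4)))) := by
        gcongr
        · exact Finset.sum_le_card_nsmul _ _ _ h1
        · exact Finset.sum_le_card_nsmul _ _ _ h2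
    _ ≤ 2 * (j • (2 * (ENNReal.ofReal (φ ^ (1 / 8 * ρ)) * weightSum φ (1 / 4))) +
        k • (2 * (ENNReal.ofReal (φ ^ (1 / 8 * ρ)) * weightSum φ (1 / 4)))) := by
        gcongr
    _ = _ := by
        simp only [nsmul_eq_mul]
        ring

/-- The extra `1` in the constant covers `ρ = 0`, which occurs as the term `l = 0` of the full
lattice sum. -/
theorem alphaMix_maxMovingAverage_le_of_nonneg [IsProbabilityMeasure P]
    (hZ : IsIIDUnitFrechet P Z) (hφ0 : 0 < φ) (hφ1 : φ < 1) (j k : ℕ) {ρ : ℝ} (hρ : 0 ≤ ρ) :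
    alphaMix P (maxMovingAverage φ Z) j k ρ ≤
      (1 + 4 * weightSum φ (1 / 4) * (j + k)) * ENNReal.ofReal (φ ^ (1 / 8 * ρ)) := by
  rcases hρ.eq_or_lt with rfl | h
  · refine (alphaMix_le_one P _ _ _ _).trans ?_
    simp
  · refine (alphaMix_maxMovingAverage_le hZ hφ0 hφ1 j k h).trans ?_
    gcongr
    exact le_add_self

/-! ### Joint exceedances at two sites and over two balls. -/

/-- The larger of `‖s-u‖`, `‖t-u‖` is at least `‖s-t‖/2` and at least `‖s-u‖`, so it dominates a
quarter of their sources' sum `‖s-t‖ + ‖s-u‖`. One factor records the separation, the other is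
summable in `u`. -/
theorem measure_pair_exceed_diag_le [IsProbabilityMeasure P] (hZ : IsIIDUnitFrechet P Z)
    (hφ0 : 0 < φ) (hφ1 : φ < 1) (s t u : Fin 2 → ℤ) {y : ℝ} (hy : 0 < y) :
    P ({ω | y < φ ^ latticeNorm (s - u) * Z u ω} ∩ {ω | y < φ ^ latticeNorm (t - u) * Z u ω}) ≤
      ENNReal.ofReal (1 / y) * ENNReal.ofReal (φ ^ (1 / 4 * latticeNorm (s - t))) *
        ENNReal.ofReal (φ ^ (1 / 4 * latticeNorm (s - u))) := by
  have h := latticeNorm_sub_le s u t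
  rw [latticeNorm_sub_comm u t] at h
  have h0 := latticeNorm_nonneg (s - u)
  have h0' := latticeNorm_nonneg (t - u)
  have bound : ∀ v : Fin 2 → ℤ,
      1 / 4 * latticeNorm (s - t) + 1 / 4 * latticeNorm (s - u) ≤ latticeNorm (v - u) →
      P {ω | y < φ ^ latticeNorm (v - u) * Z u ω} ≤
      ENNReal.ofReal (1 / y) * ENNReal.ofReal (φ ^ (1 / 4 * latticeNorm (s - t))) *
        ENNReal.ofReal (φ ^ (1 / 4 * latticeNorm (s - u))) := by
    intro v hv
    refine (hZ.measure_lt_mul_le u (by positivity) hy).trans ?_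
    rw [mul_assoc, ← ENNReal.ofReal_mul (by positivity), ← ENNReal.ofReal_mul (by positivity),
      ← Real.rpow_add hφ0, one_div_mul_eq_div]
    refine ENNReal.ofReal_le_ofReal ?_
    gcongr ?_ / y
    exact Real.rpow_le_rpow_of_exponent_ge hφ0 hφ1.le hv
  rcases le_total (latticeNorm (s - u)) (latticeNorm (t - u)) with hle | hle
  · exact (measure_mono Set.inter_subset_right).trans (bound t (by linarith))
  · exact (measure_mono Set.inter_subset_left).trans (bound s (by linarith))

theorem measure_pair_exceed_le [IsProbabilityMeasure P] (hZ : IsIIDUnitFrechet P Z)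
    (hφ0 : 0 < φ) (hφ1 : φ < 1) (s t : Fin 2 → ℤ) {y : ℝ} (hy : 0 < y) :
    P ({ω | y < |maxMovingAverage φ Z s ω|} ∩ {ω | y < |maxMovingAverage φ Z t ω|}) ≤
      ENNReal.ofReal (1 / y) * ENNReal.ofReal (φ ^ (1 / 4 * latticeNorm (s - t))) *
        weightSum φ (1 / 4) + (ENNReal.ofReal (1 / y) * weightSum φ 1) ^ 2 := by
  set A : (Fin 2 → ℤ) → (Fin 2 → ℤ) → Set Ω :=
    fun t u => {ω | y < φ ^ latticeNorm (t - u) * Z u ω}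
  have hAm : ∀ t u, P (A t u) ≤
      ENNReal.ofReal (1 / y) * ENNReal.ofReal (φ ^ (1 * latticeNorm (t - u))) := by
    intro t u
    refine (hZ.measure_lt_mul_le u (by positivity) hy).trans (le_of_eq ?_)
    rw [← ENNReal.ofReal_mul (by positivity), one_mul, one_div_mul_eq_div]
  have hoff : ∀ u v, u ≠ v → P (A s u ∩ A t v) = P (A s u) * P (A t v) := by
    intro u v huv
    have hA : ∀ t u, A t u = Z u ⁻¹' {z | y < φ ^ latticeNorm (t - u) * z} := fun _ _ => rfl
    have hm : ∀ t u : Fin 2 → ℤ, MeasurableSet {z : ℝ | y < φ ^ latticeNorm (t - u) * z} :=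
      fun t u => measurableSet_lt measurable_const (measurable_const.mul measurable_id)
    rw [hA, hA]
    exact (hZ.indep.indepFun huv).measure_inter_preimage_eq_mul _ _ (hm s u) (hm t v)
  have hsub : P ({ω | y < |maxMovingAverage φ Z s ω|} ∩ {ω | y < |maxMovingAverage φ Z t ω|}) ≤
      P ((⋃ u, A s u ∩ A t u) ∪ ⋃ u, ⋃ v, {ω | u ≠ v ∧ ω ∈ A s u ∩ A t v}) := by
    refine measure_mono_ae ?_
    filter_upwards [ae_exists_lt_of_lt_abs_maxMovingAverage hZ hφ0 s y,
      ae_exists_lt_of_lt_abs_maxMovingAverage hZ hφ0 t y] with ω h1 h2 hω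
    obtain ⟨u, hu⟩ := h1 hω.1
    obtain ⟨v, hv⟩ := h2 hω.2
    by_cases huv : u = v
    · subst huv
      exact Or.inl (Set.mem_iUnion.2 ⟨u, hu, hv⟩)
    · exact Or.inr (Set.mem_iUnion.2 ⟨u, Set.mem_iUnion.2 ⟨v, huv, hu, hv⟩⟩)
  refine hsub.trans ((measure_union_le _ _).trans (add_le_add ?_ ?_))
  · refine (measure_iUnion_le _).trans ?_
    rw [← tsum_ofReal_rpow_sub φ (1 / 4) s, ← ENNReal.tsum_mul_left]
    exact ENNReal.tsum_le_tsum fun u => measure_pair_exceed_diag_le hZ hφ0 hφ1 s t u hy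
  · calc _ ≤ ∑' u, ∑' v, P {ω | u ≠ v ∧ ω ∈ A s u ∩ A t v} :=
          (measure_iUnion_le _).trans (ENNReal.tsum_le_tsum fun u => measure_iUnion_le _)
      _ ≤ ∑' u, ∑' v, P (A s u) * P (A t v) := by
          refine ENNReal.tsum_le_tsum fun u => ENNReal.tsum_le_tsum fun v => ?_
          -- The condition `u ≠ v` empties the diagonal events, so the sum may run over all pairs
          -- and factorize.
          by_cases huv : u = v
          · simp [huv]
          · rw [← hoff u v huv]
            exact measure_mono fun ω hω => hω.2
      _ = (∑' u, P (A s u)) * ∑' v, P (A t v) := by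
          simp_rw [ENNReal.tsum_mul_left, ENNReal.tsum_mul_right]
      _ ≤ _ := by
          rw [sq]
          gcongr
          · rw [← tsum_ofReal_rpow_sub φ 1 s, ← ENNReal.tsum_mul_left]
            exact ENNReal.tsum_le_tsum (hAm s)
          · rw [← tsum_ofReal_rpow_sub φ 1 t, ← ENNReal.tsum_mul_left]
            exact ENNReal.tsum_le_tsum (hAm t)

theorem measure_ballExceed_inter_le [IsProbabilityMeasure P] (hZ : IsIIDUnitFrechet P Z)
    (hφ0 : 0 < φ) (hφ1 : φ < 1) (γ : ℝ) (l : Fin 2 → ℤ) {y : ℝ} (hy : 0 < y) :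
    P (ballExceed (maxMovingAverage φ Z) γ 0 y ∩ ballExceed (maxMovingAverage φ Z) γ l y) ≤
      (ballCard 2 γ : ℝ≥0∞) ^ 2 *
        (ENNReal.ofReal (1 / y) * ENNReal.ofReal (φ ^ (1 / 4 * (latticeNorm l - 2 * γ))) *
          weightSum φ (1 / 4) + (ENNReal.ofReal (1 / y) * weightSum φ 1) ^ 2) := by
  set B : Finset (Fin 2 → ℤ) := (latticeBall_finite γ (0 : Fin 2 → ℤ)).toFinset
  have hB : ∀ b, b ∈ B ↔ latticeNorm b ≤ γ := fun b => by simp [B, latticeBall]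
  have hcard : B.card = ballCard 2 γ := (Set.ncard_eq_toFinset_card _ _).symm
  set E : (Fin 2 → ℤ) → Set Ω := fun s => {ω | y < |maxMovingAverage φ Z s ω|}
  have hsub : ballExceed (maxMovingAverage φ Z) γ 0 y ∩ ballExceed (maxMovingAverage φ Z) γ l y ⊆
      ⋃ s ∈ B, ⋃ b ∈ B, E s ∩ E (l + b) := by
    rintro ω ⟨⟨s, hs, h1⟩, ⟨t, ht, h2⟩⟩
    simp only [Set.mem_iUnion]
    refine ⟨s, (hB s).2 (by simpa [latticeBall] using hs), t - l,
      (hB _).2 (by simpa [latticeBall] using ht), h1, ?_⟩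
    rwa [add_sub_cancel]
  refine (measure_mono hsub).trans ?_
  refine (measure_biUnion_finset_le _ _).trans ?_
  refine (Finset.sum_le_sum fun s _ => measure_biUnion_finset_le _ _).trans ?_
  have hterm : ∀ s ∈ B, ∀ b ∈ B, P (E s ∩ E (l + b)) ≤
      ENNReal.ofReal (1 / y) * ENNReal.ofReal (φ ^ (1 / 4 * (latticeNorm l - 2 * γ))) *
          weightSum φ (1 / 4) + (ENNReal.ofReal (1 / y) * weightSum φ 1) ^ 2 := by
    intro s hs b hb
    refine (measure_pair_exceed_le hZ hφ0 hφ1 s (l + b) hy).trans ?_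
    -- Points of the two balls are at distance at least `‖l‖ - 2γ`.
    have h1 := latticeNorm_add_le (l + b - s) (s - b)
    have h2 := latticeNorm_sub_le s 0 b
    have h3 := (hB s).1 hs
    have h4 := (hB b).1 hb
    rw [sub_zero, zero_sub, latticeNorm_neg] at h2
    rw [latticeNorm_sub_comm (l + b) s, show l + b - s + (s - b) = l by abel] at h1
    gcongr _ * ENNReal.ofReal ?_ * _ + _
    exact Real.rpow_le_rpow_of_exponent_ge hφ0 hφ1.le (by linarith)
  refine (Finset.sum_le_sum fun s hs => Finset.sum_le_card_nsmul _ _ _ (hterm s hs)).trans ?_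
  rw [Finset.sum_const, hcard, nsmul_eq_mul, nsmul_eq_mul, ← mul_assoc, ← sq]

/-! ### Limits under the growth conditions. -/

theorem tendsto_mul_rpow_zero {φ c : ℝ} (hφ0 : 0 < φ) (hφ1 : φ < 1) (hc : 0 < c) {x r : ℕ → ℝ}
    (hx : ∀ᶠ n in atTop, 0 < x n) (hr : Tendsto r atTop atTop)
    (hxr : (fun n => Real.log (x n)) =o[atTop] r) :
    Tendsto (fun n => x n * φ ^ (c * r n)) atTop (𝓝 0) := by
  have hlog : Real.log φ < 0 := Real.log_neg hφ0 hφ1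
  -- Half the decay rate: `φ^(c r) = e^(-2κr)` while eventually `x ≤ e^(κr)`, so the product is at
  -- most `e^(-κr)`.
  set κ : ℝ := c * -Real.log φ / 2
  have hκ : 0 < κ := by
    have : 0 < c * -Real.log φ := mul_pos hc (by linarith)
    positivity
  have hlim : Tendsto (fun n => Real.exp (-(κ * r n))) atTop (𝓝 0) :=
    Real.tendsto_exp_neg_atTop_nhds_zero.comp (hr.const_mul_atTop hκ)
  refine tendsto_of_tendsto_of_tendsto_of_le_of_le' tendsto_const_nhds hlim ?_ ?_
  · filter_upwards [hx] with n hn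
    positivity
  · filter_upwards [hx, hr.eventually_ge_atTop 0, hxr.bound hκ] with n hn hrn hb
    rw [Real.norm_eq_abs, Real.norm_eq_abs, abs_of_nonneg hrn] at hb
    have h1 := (le_abs_self _).trans hb
    rw [Real.rpow_def_of_pos hφ0]
    nth_rewrite 1 [← Real.exp_log hn]
    rw [← Real.exp_add]
    refine Real.exp_le_exp.2 ?_
    have e : Real.log φ * (c * r n) = -(2 * κ * r n) := by simp only [κ]; ring
    rw [e]
    linarith

theorem tsum_alphaMix_subtype_le [IsProbabilityMeasure P] (hZ : IsIIDUnitFrechet P Z)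
    (hφ0 : 0 < φ) (hφ1 : φ < 1) (j k : ℕ) {R : ℝ} {p : (Fin 2 → ℤ) → Prop}
    (hp : ∀ l, p l → R ≤ latticeNorm l) :
    ∑' l : {l // p l}, alphaMix P (maxMovingAverage φ Z) j k (latticeNorm l.1) ≤
      (1 + 4 * weightSum φ (1 / 4) * (j + k)) * weightSum φ (1 / 16) *
        ENNReal.ofReal (φ ^ (1 / 16 * R)) := by
  have hterm : ∀ l : {l // p l},
      alphaMix P (maxMovingAverage φ Z) j k (latticeNorm l.1) ≤ _ := fun l =>
    alphaMix_maxMovingAverage_le_of_nonneg hZ hφ0 hφ1 j k (latticeNorm_nonneg l.1)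
  refine (ENNReal.tsum_le_tsum hterm).trans ?_
  rw [ENNReal.tsum_mul_left, mul_assoc _ (weightSum φ (1 / 16)),
    mul_comm (weightSum φ (1 / 16))]
  refine mul_le_mul_right ?_ _
  refine (tsum_subtype_rpow_le hφ0 hφ1 (by norm_num) hp).trans (le_of_eq ?_)
  norm_num

theorem mixingConst_ne_top (hφ0 : 0 < φ) (hφ1 : φ < 1) (j k : ℕ) :
    1 + 4 * weightSum φ (1 / 4) * (j + k) ≠ ∞ := by
  have h := weightSum_ne_top hφ0 hφ1 (show (0 : ℝ) < 1 / 4 by norm_num)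
  finiteness

theorem tsum_alphaMix_lt_top [IsProbabilityMeasure P] (hZ : IsIIDUnitFrechet P Z)
    (hφ0 : 0 < φ) (hφ1 : φ < 1) (j k : ℕ) :
    ∑' l : Fin 2 → ℤ, alphaMix P (maxMovingAverage φ Z) j k (latticeNorm l) < ∞ := by
  refine (ENNReal.tsum_le_tsum fun l =>
    alphaMix_maxMovingAverage_le_of_nonneg hZ hφ0 hφ1 j k (latticeNorm_nonneg l)).trans_lt ?_
  rw [ENNReal.tsum_mul_left]
  exact ENNReal.mul_lt_top (mixingConst_ne_top hφ0 hφ1 j k).lt_top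
    (weightSum_ne_top hφ0 hφ1 (by norm_num)).lt_top

theorem tendsto_mul_tsum_alphaMix [IsProbabilityMeasure P] (hZ : IsIIDUnitFrechet P Z)
    (hφ0 : 0 < φ) (hφ1 : φ < 1) (j k : ℕ) {m r : ℕ → ℝ} (hm : Tendsto m atTop atTop)
    (hr : Tendsto r atTop atTop) (hmr : (fun n => Real.log (m n)) =o[atTop] r) :
    Tendsto (fun n : ℕ => ENNReal.ofReal (m n) *
        ∑' l : {l : Fin 2 → ℤ // r n < latticeNorm l},
          alphaMix P (maxMovingAverage φ Z) j k (latticeNorm l.1)) atTop (𝓝 0) := by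
  have hpos := hm.eventually_gt_atTop 0
  have hlim := ENNReal.Tendsto.const_mul
    (a := (1 + 4 * weightSum φ (1 / 4) * (j + k)) * weightSum φ (1 / 16))
    (ENNReal.tendsto_ofReal (tendsto_mul_rpow_zero hφ0 hφ1 (c := 1 / 16) (by norm_num) hpos hr hmr))
    (Or.inr (ENNReal.mul_ne_top (mixingConst_ne_top hφ0 hφ1 j k)
      (weightSum_ne_top hφ0 hφ1 (by norm_num))))
  rw [ENNReal.ofReal_zero, mul_zero] at hlim
  refine tendsto_of_tendsto_of_tendsto_of_le_of_le' tendsto_const_nhds hlim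
    (Eventually.of_forall fun _ => bot_le) ?_
  filter_upwards [hpos] with n hn
  rw [ENNReal.ofReal_mul hn.le, mul_left_comm]
  gcongr
  exact tsum_alphaMix_subtype_le hZ hφ0 hφ1 j k fun l hl => le_of_lt hl

theorem tendsto_block_alphaMix [IsProbabilityMeasure P] (hZ : IsIIDUnitFrechet P Z)
    (hφ0 : 0 < φ) (hφ1 : φ < 1) (b : ℕ) {m : ℕ → ℝ} (hm : Tendsto m atTop atTop)
    (hnm : (fun n : ℕ => Real.log (n : ℝ)) =o[atTop] m) :
    Tendsto (fun n : ℕ => ENNReal.ofReal (n * (m n) ^ ((1 : ℝ) / 2)) *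
        alphaMix P (maxMovingAverage φ Z) b (b * n ^ 2) (m n)) atTop (𝓝 0) := by
  have hpos := hm.eventually_gt_atTop 0
  have h1 : Tendsto (fun n => m n * φ ^ (1 / 16 * m n)) atTop (𝓝 0) :=
    tendsto_mul_rpow_zero hφ0 hφ1 (by norm_num) hpos hm
      (Real.isLittleO_log_id_atTop.comp_tendsto hm)
  -- One power of `n` is the prefactor and two come from the cardinality `b * n ^ 2`. The rate `1/8`
  -- is shared equally between `m n` and `n ^ 3`.
  have h2 : Tendsto (fun n : ℕ => (n : ℝ) ^ 3 * φ ^ (1 / 16 * m n)) atTop (𝓝 0) := by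
    refine tendsto_mul_rpow_zero hφ0 hφ1 (by norm_num) ?_ hm ?_
    · filter_upwards [eventually_gt_atTop 0] with n hn
      have : (0 : ℝ) < n := by exact_mod_cast hn
      positivity
    · simpa only [Real.log_pow] using hnm.const_mul_left ((3 : ℕ) : ℝ)
  have h3 := h1.mul h2
  rw [mul_zero] at h3
  have hlim := ENNReal.Tendsto.const_mul
    (a := (1 + 4 * weightSum φ (1 / 4) * ((2 * b : ℕ) + (0 : ℕ)))) (ENNReal.tendsto_ofReal h3)
    (Or.inr (mixingConst_ne_top hφ0 hφ1 (2 * b) 0))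
  rw [ENNReal.ofReal_zero, mul_zero] at hlim
  refine tendsto_of_tendsto_of_tendsto_of_le_of_le' tendsto_const_nhds hlim
    (Eventually.of_forall fun _ => bot_le) ?_
  filter_upwards [hm.eventually_ge_atTop 1, eventually_ge_atTop 1] with n hmn hn
  have hn1 : (1 : ℝ) ≤ n := by exact_mod_cast hn
  have hn1' : (1 : ℝ≥0∞) ≤ (n : ℝ≥0∞) ^ 2 := one_le_pow₀ (by exact_mod_cast hn)
  have hC : 1 + 4 * weightSum φ (1 / 4) * ((b : ℕ) + (b * n ^ 2 : ℕ)) ≤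
      (1 + 4 * weightSum φ (1 / 4) * ((2 * b : ℕ) + (0 : ℕ))) * (n : ℝ≥0∞) ^ 2 := by
    rw [add_mul, one_mul]
    refine add_le_add hn1' ?_
    rw [mul_assoc _ _ ((n : ℝ≥0∞) ^ 2)]
    refine mul_le_mul_right ?_ _
    push_cast
    calc (b : ℝ≥0∞) + b * n ^ 2 ≤ b * n ^ 2 + b * n ^ 2 := by
          gcongr
          exact le_mul_of_one_le_right' hn1'
      _ = _ := by ring
  calc _ ≤ ENNReal.ofReal (n * m n) *
        ((1 + 4 * weightSum φ (1 / 4) * ((2 * b : ℕ) + (0 : ℕ))) * (n : ℝ≥0∞) ^ 2 *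
          ENNReal.ofReal (φ ^ (1 / 8 * m n))) := by
        gcongr
        · exact Real.rpow_le_self_of_one_le hmn (by norm_num)
        · refine (alphaMix_maxMovingAverage_le_of_nonneg hZ hφ0 hφ1 b _ (by linarith)).trans ?_
          gcongr
    _ = (1 + 4 * weightSum φ (1 / 4) * ((2 * b : ℕ) + (0 : ℕ))) *
        (ENNReal.ofReal (n * m n) * (ENNReal.ofReal ((n : ℝ) ^ 2) *
          ENNReal.ofReal (φ ^ (1 / 8 * m n)))) := by
        rw [ENNReal.ofReal_pow (by positivity), ENNReal.ofReal_natCast]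
        ring
    _ = _ := by
        rw [← ENNReal.ofReal_mul (by positivity), ← ENNReal.ofReal_mul (by positivity)]
        have e : (1 / 8 : ℝ) * m n = 1 / 16 * m n + 1 / 16 * m n := by ring
        rw [e, Real.rpow_add hφ0]
        congr 2
        ring

/-- Bound on the anti-clustering sum; the first summand is small for large `k`, the second one is
`O(r^2 / m)`. -/
theorem mul_tsum_ballExceed_le [IsProbabilityMeasure P] (hZ : IsIIDUnitFrechet P Z)
    (hφ0 : 0 < φ) (hφ1 : φ < 1) (γ : ℝ) (k : ℝ) {m r y δ : ℝ} (hm : 0 < m) (hr : 1 ≤ r)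
    (hy : 0 < y) (hδ : 0 ≤ δ) (hmy : 1 / y ≤ δ / m) :
    ENNReal.ofReal m * ∑' l : {l : Fin 2 → ℤ // k < latticeNorm l ∧ latticeNorm l ≤ r},
        P (ballExceed (maxMovingAverage φ Z) γ 0 y ∩ ballExceed (maxMovingAverage φ Z) γ l.1 y) ≤
      (ballCard 2 γ : ℝ≥0∞) ^ 2 * ENNReal.ofReal δ * ENNReal.ofReal (φ ^ (-(γ / 2))) *
          weightSum φ (1 / 4) * weightSum φ (1 / 8) * ENNReal.ofReal (φ ^ (1 / 8 * k)) +
        (ballCard 2 γ : ℝ≥0∞) ^ 2 * weightSum φ 1 ^ 2 * ENNReal.ofReal (9 * δ ^ 2) *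
          ENNReal.ofReal (r ^ 2 / m) := by
  set C := (ballCard 2 γ : ℝ≥0∞) ^ 2
  have hI : ENNReal.ofReal (1 / y) ≤ ENNReal.ofReal (δ / m) := ENNReal.ofReal_le_ofReal hmy
  have hmδ : ENNReal.ofReal m * ENNReal.ofReal (δ / m) = ENNReal.ofReal δ := by
    rw [← ENNReal.ofReal_mul hm.le]
    congr 1
    field_simp
  have hterm : ∀ l : {l : Fin 2 → ℤ // k < latticeNorm l ∧ latticeNorm l ≤ r},
      P (ballExceed (maxMovingAverage φ Z) γ 0 y ∩ ballExceed (maxMovingAverage φ Z) γ l.1 y) ≤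
        C * ENNReal.ofReal (δ / m) * ENNReal.ofReal (φ ^ (-(γ / 2))) * weightSum φ (1 / 4) *
          ENNReal.ofReal (φ ^ (1 / 4 * latticeNorm l.1)) +
        C * (ENNReal.ofReal (δ / m) * weightSum φ 1) ^ 2 := by
    intro l
    refine (measure_ballExceed_inter_le hZ hφ0 hφ1 γ l.1 hy).trans ?_
    have e : (1 / 4 : ℝ) * (latticeNorm l.1 - 2 * γ) = -(γ / 2) + 1 / 4 * latticeNorm l.1 := by
      ring
    rw [e, Real.rpow_add hφ0, ENNReal.ofReal_mul (by positivity), mul_add]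
    refine add_le_add ?_ (by gcongr)
    calc _ ≤ C * (ENNReal.ofReal (δ / m) * (ENNReal.ofReal (φ ^ (-(γ / 2))) *
          ENNReal.ofReal (φ ^ (1 / 4 * latticeNorm l.1))) * weightSum φ (1 / 4)) := by gcongr
      _ = _ := by ring
  calc _ ≤ ENNReal.ofReal m *
        (C * ENNReal.ofReal (δ / m) * ENNReal.ofReal (φ ^ (-(γ / 2))) * weightSum φ (1 / 4) *
          (ENNReal.ofReal (φ ^ (1 / 8 * k)) * weightSum φ (1 / 8)) +
        ENNReal.ofReal (9 * r ^ 2) * (C * (ENNReal.ofReal (δ / m) * weightSum φ 1) ^ 2)) := by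
        gcongr
        refine (ENNReal.tsum_le_tsum hterm).trans ?_
        rw [ENNReal.tsum_add, ENNReal.tsum_mul_left]
        refine add_le_add ?_ ?_
        · gcongr
          refine (tsum_subtype_rpow_le hφ0 hφ1 (by norm_num) fun l hl => hl.1.le).trans
            (le_of_eq ?_)
          norm_num
        -- The hypothesis `1 ≤ r` turns `(2r+1)²` into `9r²`.
        · refine (tsum_subtype_const_le (by linarith) _ fun l hl => hl.2).trans ?_
          gcongr
          nlinarith
    _ = C * (ENNReal.ofReal m * ENNReal.ofReal (δ / m)) * ENNReal.ofReal (φ ^ (-(γ / 2))) *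
          weightSum φ (1 / 4) * weightSum φ (1 / 8) * ENNReal.ofReal (φ ^ (1 / 8 * k)) +
        C * weightSum φ 1 ^ 2 * ((ENNReal.ofReal m * ENNReal.ofReal (δ / m)) *
          ENNReal.ofReal (δ / m) * ENNReal.ofReal (9 * r ^ 2)) := by ring
    _ = _ := by
        rw [hmδ, ← ENNReal.ofReal_mul hδ, ← ENNReal.ofReal_mul (by positivity),
          mul_assoc _ (ENNReal.ofReal (9 * δ ^ 2)), ← ENNReal.ofReal_mul (by positivity)]
        congr 3
        ring

theorem tendsto_limsup_anticluster [IsProbabilityMeasure P] (hZ : IsIIDUnitFrechet P Z)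
    (hφ0 : 0 < φ) (hφ1 : φ < 1) (γ : ℝ) {a : ℝ → ℝ} (ha : ∀ᶠ x in atTop, x / 4 ≤ a x)
    {m r : ℕ → ℝ} (hm : Tendsto m atTop atTop) (hr : Tendsto r atTop atTop)
    (hrm : (fun n => (r n) ^ 2) =o[atTop] m) {ε : ℝ} (hε : 0 < ε) :
    Tendsto (fun k : ℕ => limsup (fun n : ℕ => ENNReal.ofReal (m n) *
        ∑' l : {l : Fin 2 → ℤ // (k : ℝ) < latticeNorm l ∧ latticeNorm l ≤ r n},
          P (ballExceed (maxMovingAverage φ Z) γ 0 (ε * a (m n)) ∩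
            ballExceed (maxMovingAverage φ Z) γ l.1 (ε * a (m n)))) atTop)
      atTop (𝓝 0) := by
  have hW1 := weightSum_ne_top hφ0 hφ1 (show (0 : ℝ) < 1 by norm_num)
  have hW4 := weightSum_ne_top hφ0 hφ1 (show (0 : ℝ) < 1 / 4 by norm_num)
  have hW8 := weightSum_ne_top hφ0 hφ1 (show (0 : ℝ) < 1 / 8 by norm_num)
  -- From `a_m ≥ m/4`: `1/(ε a_m) ≤ (4/ε)/m`.
  set δ : ℝ := 4 / ε
  set K₁ : ℝ≥0∞ := (ballCard 2 γ : ℝ≥0∞) ^ 2 * ENNReal.ofReal δ *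
    ENNReal.ofReal (φ ^ (-(γ / 2))) * weightSum φ (1 / 4) * weightSum φ (1 / 8)
  set K₂ : ℝ≥0∞ := (ballCard 2 γ : ℝ≥0∞) ^ 2 * weightSum φ 1 ^ 2 * ENNReal.ofReal (9 * δ ^ 2)
  have hK₁ : K₁ ≠ ∞ := by finiteness
  have hK₂ : K₂ ≠ ∞ := by finiteness
  have hlim₁ : Tendsto (fun k : ℕ => K₁ * ENNReal.ofReal (φ ^ (1 / 8 * (k : ℝ)))) atTop (𝓝 0) := by
    have h := ENNReal.Tendsto.const_mul (ENNReal.tendsto_ofReal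
      (tendsto_mul_rpow_zero (x := fun _ => 1) hφ0 hφ1 (c := 1 / 8) (by norm_num)
      (Eventually.of_forall fun _ => one_pos) tendsto_natCast_atTop_atTop (by simp)))
      (Or.inr hK₁)
    simpa only [one_mul, ENNReal.ofReal_zero, mul_zero] using h
  have hlim₂ : Tendsto (fun n => K₂ * ENNReal.ofReal (r n ^ 2 / m n)) atTop (𝓝 0) := by
    have h := ENNReal.Tendsto.const_mul (ENNReal.tendsto_ofReal hrm.tendsto_div_nhds_zero)
      (Or.inr hK₂)
    simpa only [ENNReal.ofReal_zero, mul_zero] using h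
  refine tendsto_of_tendsto_of_tendsto_of_le_of_le tendsto_const_nhds hlim₁
    (fun _ => bot_le) fun k => ?_
  have hlim₃ := (tendsto_const_nhds (x := K₁ * ENNReal.ofReal (φ ^ (1 / 8 * (k : ℝ))))).add hlim₂
  rw [add_zero] at hlim₃
  -- For fixed `k` the `r²/m` term vanishes as `n → ∞`; only the `φ^(k/8)` term survives the limsup.
  refine le_trans (limsup_le_limsup ?_) hlim₃.limsup_eq.le
  filter_upwards [hm.eventually_gt_atTop 0, hr.eventually_ge_atTop 1, hm.eventually ha]
    with n hmn hrn han
  have hmy : ε * (m n / 4) ≤ ε * a (m n) := by gcongr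
  have hmy0 : 0 < ε * (m n / 4) := by positivity
  refine mul_tsum_ballExceed_le hZ hφ0 hφ1 γ k hmn hrn (hmy0.trans_le hmy) (by positivity) ?_
  refine (one_div_le_one_div_of_le hmy0 hmy).trans (le_of_eq ?_)
  simp only [δ]
  field_simp

end ExtremogramMMA

theorem mainTheorem8 {Ω : Type*} [MeasurableSpace Ω] (P : Measure Ω) [IsProbabilityMeasure P]
    (Z : (Fin 2 → ℤ) → Ω → ℝ) (hZ : ExtremogramMMA.IsIIDUnitFrechet P Z)
    (φ : ℝ) (hφ0 : 0 < φ) (hφ1 : φ < 1)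
    (γ : ℝ) (hγ : 0 ≤ γ)
    (a : ℝ → ℝ)
    (ha : (fun x : ℝ => P.real {ω | a x < |ExtremogramMMA.maxMovingAverage φ Z 0 ω|})
      ~[atTop] (fun x : ℝ => 1 / x))
    (m r : ℕ → ℝ) (hm : Tendsto m atTop atTop) (hr : Tendsto r atTop atTop)
    (hrm : (fun n => (r n) ^ 2) =o[atTop] m)
    (hmr : (fun n => Real.log (m n)) =o[atTop] r)
    (hnm : (fun n : ℕ => Real.log (n : ℝ)) =o[atTop] m) :
    ExtremogramMMA.ClusterMixingConditions P (ExtremogramMMA.maxMovingAverage φ Z) γ m r a where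
  anticluster _ hε := ExtremogramMMA.tendsto_limsup_anticluster hZ hφ0 hφ1 γ
    (ExtremogramMMA.eventually_div_four_le hZ hφ0 hφ1 ha) hm hr hrm hε
  mixing_tail := ExtremogramMMA.tendsto_mul_tsum_alphaMix hZ hφ0 hφ1 _ _ hm hr hmr
  mixing_summable j₁ j₂ _ _ := ExtremogramMMA.tsum_alphaMix_lt_top hZ hφ0 hφ1 j₁ j₂
  mixing_block := by
    simpa using ExtremogramMMA.tendsto_block_alphaMix hZ hφ0 hφ1 (ExtremogramMMA.ballCard 2 γ) hm hnm
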